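/- Let $\mathbf O$ be the octonions with conjugation $x\mapsto\overline{x}$, inner product $(x|y)=\mathrm{Re}(x\overline{y})$ and unit element $1$. For $\xi_i\in\mathbb R$, $x_i\in\mathbf O$ put $$h^1(\xi_1,\xi_2,\xi_3;x_1,x_2,x_3)=\begin{pmatrix}\xi_1&\sqrt{-1}\,x_3&\sqrt{-1}\,\overline{x_2}\\ \sqrt{-1}\,\overline{x_3}&\xi_2&x_1\\ \sqrt{-1}\,x_2&\overline{x_1}&\xi_3\end{pmatrix}$$ (a matrix over the complexified octonions), and let $\mathcal J^1$ be the real $27$-dimensional Jordan algebra of all these matrices, with product $X\circ Y=\frac12(XY+YX)$. Let $$G=\mathrm F_{4(-20)}=\{g\in \mathrm{GL}_{\mathbb R}(\mathcal J^1)\mid g(X\circ Y)=gX\circ gY \text{ for all } X,Y\in\mathcal J^1\},$$ with Lie algebra $\mathfrak g=\mathfrak f_{4(-20)}\subset\mathrm{End}_{\mathbb R}(\mathcal J^1)$. Let $\sigma\in G$ be the involution $h^1(\xi_1,\xi_2,\xi_3;x_1,x_2,x_3)\mapsto h^1(\xi_1,\xi_2,\xi_3;x_1,-x_2,-x_3)$,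 let $\theta(\phi)=\sigma\phi\sigma^{-1}$ be the corresponding Cartan involution of $\mathfrak g$, let $K=\{g\in G\mid \sigma g\sigma^{-1}=g\}$, and let $\mathfrak k=\{\phi\in\mathfrak g\mid\theta\phi=\phi\}$. Let $\tilde A=\tilde A_3^1(1)\in\mathfrak g$ be the map $X\mapsto TX-XT$ with $$T=\begin{pmatrix}0&\sqrt{-1}&0\\-\sqrt{-1}&0&0\\0&0&0\end{pmatrix},$$ let $\mathfrak a=\mathbb R\tilde A$, and let $\alpha\in\mathfrak a^*$ be given by $\alpha(\tilde A)=1$. Put $$M=\{k\in K\mid k\tilde Ak^{-1}=\tilde A\},\qquad M^*=N_K(\mathfrak a)=\{k\in K\mid k\mathfrak ak^{-1}=\mathfrak a\},\qquad W=M^*/M,$$ and $\mathfrak m=\{\phi\in\mathfrak k\mid[\phi,\tilde A]=0\}$. For $\lambda\in\mathfrak a^*$ let $\mathfrak g_\lambda=\{\phi\in\mathfrak g\mid[H,\phi]=\lambda(H)\phi\text{ for all }H\in\mathfrak a\}$; the set of roots $\{\lambda\ne0\mid\mathfrak g_\lambda\neq0\}$ is $\Sigma=\{\pm\alpha,\pm2\alpha\}$,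 and $\mathfrak g=\mathfrak a\oplus\mathfrak m\oplus\bigoplus_{\lambda\in\Sigma}\mathfrak g_\lambda$. Let $\epsilon(\pm\alpha)=-1$ and $\epsilon(\pm2\alpha)=1$, and let $\theta_\epsilon$ be the linear map of $\mathfrak g$ that equals $\epsilon(\lambda)\theta$ on $\mathfrak g_\lambda$ for $\lambda\in\Sigma$ and $\theta$ on $\mathfrak a\oplus\mathfrak m$. Let $(K_\epsilon)^0$ be the connected Lie subgroup of $G$ with Lie algebra $\mathfrak k_\epsilon=\{\phi\in\mathfrak g\mid\theta_\epsilon\phi=\phi\}$, that is, the subgroup generated by $\exp\mathfrak k_\epsilon$; let $K_\epsilon=(K_\epsilon)^0M$, which is a subgroup because $M$ normalizes $(K_\epsilon)^0$, and put $M^*_\epsilon=K_\epsilon\cap M^*$ and $W_\epsilon=M^*_\epsilon/M\subset W$. **Proposition.** (1) $M^*=M\sqcup\sigma M$ (disjoint union), and $\sigma\in M^*$. Consequently $W=\{M,\sigma M\}$ with $M\ne\sigma M$, the map $g\mapsto gM$ is an isomorphism of $\{1,\sigma\}$ onto $W$, and both groups are isomorphic to $\mathbb Z_2$. (2) $M^*_\epsilon=M^*=M\sqcup\sigma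 M$. Consequently $W_\epsilon=\{M,\sigma M\}=W$, the map $g\mapsto gM$ is an isomorphism $\{1,\sigma\}\cong W_\epsilon\cong\mathbb Z_2$, and $[W:W_\epsilon]=1$. -/

import Mathlib

open scoped Quaternion

noncomputable section

namespace ExcF4

/-- The octonions over a commutative ring `R`, obtained from Hamilton's quaternions over `R` by the
Cayley-Dickson process: the element `(a, b)` stands for `a + b ℓ`.
`Oct ℝ` is the classical division algebra of octonions, `Oct ℂ` its complexification. -/
@[ext]
structure Oct (R : Type) [CommRing R] where
  /-- the first quaternion -/
  fst : ℍ[R]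
  /-- the second quaternion -/
  snd : ℍ[R]

namespace Oct

section Algebra

variable {R : Type} [CommRing R]

instance : Zero (Oct R) := ⟨⟨0, 0⟩⟩
instance : One (Oct R) := ⟨⟨1, 0⟩⟩
instance : Add (Oct R) := ⟨fun x y => ⟨x.fst + y.fst, x.snd + y.snd⟩⟩
instance : Neg (Oct R) := ⟨fun x => ⟨-x.fst, -x.snd⟩⟩
instance : Sub (Oct R) := ⟨fun x y => ⟨x.fst - y.fst, x.snd - y.snd⟩⟩
instance : SMul R (Oct R) := ⟨fun r x => ⟨r • x.fst, r • x.snd⟩⟩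

/-- The octonion product `(a, b) (c, d) = (a c - d̄ b, d a + b c̄)`. -/
instance : Mul (Oct R) :=
  ⟨fun x y => ⟨x.fst * y.fst - star y.snd * x.snd, y.snd * x.fst + x.snd * star y.fst⟩⟩

/-- The octonion conjugation `x ↦ x̄`, `(a, b) ↦ (ā, -b)`. -/
instance : Star (Oct R) := ⟨fun x => ⟨star x.fst, -x.snd⟩⟩

@[simp] theorem fst_zero : (0 : Oct R).fst = 0 := rfl
@[simp] theorem snd_zero : (0 : Oct R).snd = 0 := rfl
@[simp] theorem fst_one : (1 : Oct R).fst = 1 := rfl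
@[simp] theorem snd_one : (1 : Oct R).snd = 0 := rfl
@[simp] theorem fst_add (x y : Oct R) : (x + y).fst = x.fst + y.fst := rfl
@[simp] theorem snd_add (x y : Oct R) : (x + y).snd = x.snd + y.snd := rfl
@[simp] theorem fst_neg (x : Oct R) : (-x).fst = -x.fst := rfl
@[simp] theorem snd_neg (x : Oct R) : (-x).snd = -x.snd := rfl
@[simp] theorem fst_sub (x y : Oct R) : (x - y).fst = x.fst - y.fst := rfl
@[simp] theorem snd_sub (x y : Oct R) : (x - y).snd = x.snd - y.snd := rfl
@[simp] theorem fst_smul (r : R) (x : Oct R) : (r • x).fst = r • x.fst := rfl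
@[simp] theorem snd_smul (r : R) (x : Oct R) : (r • x).snd = r • x.snd := rfl
@[simp] theorem fst_mul (x y : Oct R) :
    (x * y).fst = x.fst * y.fst - star y.snd * x.snd := rfl
@[simp] theorem snd_mul (x y : Oct R) :
    (x * y).snd = y.snd * x.fst + x.snd * star y.fst := rfl
@[simp] theorem fst_star (x : Oct R) : (star x).fst = star x.fst := rfl
@[simp] theorem snd_star (x : Oct R) : (star x).snd = -x.snd := rfl

instance : AddCommGroup (Oct R) where
  add_assoc x y z := by ext1 <;> simp [add_assoc]
  zero_add x := by ext1 <;> simp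
  add_zero x := by ext1 <;> simp
  add_comm x y := by ext1 <;> simp [add_comm]
  neg_add_cancel x := by ext1 <;> simp
  sub_eq_add_neg x y := by ext1 <;> simp [sub_eq_add_neg]
  nsmul := nsmulRec
  zsmul := zsmulRec

instance : Module R (Oct R) where
  one_smul x := by ext1 <;> simp
  mul_smul r s x := by ext1 <;> simp [mul_smul]
  smul_zero r := by ext1 <;> simp
  smul_add r x y := by ext1 <;> simp
  add_smul r s x := by ext1 <;> simp [add_smul]
  zero_smul x := by ext1 <;> simp

instance : NonAssocRing (Oct R) where
  left_distrib x y z := by ext1 <;> simp [mul_add, add_mul] <;> abel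
  right_distrib x y z := by ext1 <;> simp [mul_add, add_mul] <;> abel
  zero_mul x := by ext1 <;> simp
  mul_zero x := by ext1 <;> simp
  one_mul x := by ext1 <;> simp
  mul_one x := by ext1 <;> simp
  natCast_zero := by simp [Nat.unaryCast]
  natCast_succ n := by simp [Nat.unaryCast]
  intCast_negSucc n := by simp [Int.castDef]

instance : IsScalarTower R (Oct R) (Oct R) where
  smul_assoc r x y := by ext1 <;> simp [smul_sub]

instance : SMulCommClass R (Oct R) (Oct R) where
  smul_comm r x y := by ext1 <;> simp [smul_sub]

instance : StarRing (Oct R) where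
  star_involutive x := by ext1 <;> simp
  star_add x y := by ext1 <;> simp [add_comm]
  star_mul x y := by ext1 <;> simp

theorem mul_smul' (r : R) (x y : Oct R) : x * (r • y) = r • (x * y) := mul_smul_comm r x y

theorem smul_mul' (r : R) (x y : Oct R) : (r • x) * y = r • (x * y) := smul_mul_assoc r x y

theorem star_smul' (r : R) (x : Oct R) : star (r • x) = r • star x := by ext1 <;> simp

/-- The underlying pair of quaternions. -/
def toProd : Oct R ≃ₗ[R] ℍ[R] × ℍ[R] where
  toFun x := (x.fst, x.snd)
  invFun p := ⟨p.1, p.2⟩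
  map_add' _ _ := rfl
  map_smul' _ _ := rfl

end Algebra

instance : NormedAddCommGroup (Oct ℝ) :=
  NormedAddCommGroup.induced (Oct ℝ) (ℍ[ℝ] × ℍ[ℝ]) (toProd (R := ℝ)) (toProd (R := ℝ)).injective

instance : NormedSpace ℝ (Oct ℝ) :=
  NormedSpace.induced ℝ (Oct ℝ) (ℍ[ℝ] × ℍ[ℝ]) (toProd (R := ℝ))

instance : FiniteDimensional ℝ (Oct ℝ) :=
  (toProd (R := ℝ)).symm.finiteDimensional

/-- The scalar `r` as an octonion. -/
def ofScalar (r : ℂ) : Oct ℂ := r • 1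

/-- The inclusion of the octonions into their complexification. -/
def complexify (x : Oct ℝ) : Oct ℂ :=
  ⟨⟨x.fst.re, x.fst.imI, x.fst.imJ, x.fst.imK⟩, ⟨x.snd.re, x.snd.imI, x.snd.imJ, x.snd.imK⟩⟩

@[simp] theorem fst_re_complexify (x : Oct ℝ) : x.complexify.fst.re = x.fst.re := rfl
@[simp] theorem fst_imI_complexify (x : Oct ℝ) : x.complexify.fst.imI = x.fst.imI := rfl
@[simp] theorem fst_imJ_complexify (x : Oct ℝ) : x.complexify.fst.imJ = x.fst.imJ := rfl
@[simp] theorem fst_imK_complexify (x : Oct ℝ) : x.complexify.fst.imK = x.fst.imK := rfl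
@[simp] theorem snd_re_complexify (x : Oct ℝ) : x.complexify.snd.re = x.snd.re := rfl
@[simp] theorem snd_imI_complexify (x : Oct ℝ) : x.complexify.snd.imI = x.snd.imI := rfl
@[simp] theorem snd_imJ_complexify (x : Oct ℝ) : x.complexify.snd.imJ = x.snd.imJ := rfl
@[simp] theorem snd_imK_complexify (x : Oct ℝ) : x.complexify.snd.imK = x.snd.imK := rfl

theorem complexify_add (x y : Oct ℝ) : (x + y).complexify = x.complexify + y.complexify := by
  ext <;> simp

theorem complexify_sub (x y : Oct ℝ) : (x - y).complexify = x.complexify - y.complexify := by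
  ext <;> simp

theorem complexify_smul (r : ℝ) (x : Oct ℝ) :
    (r • x).complexify = (r : ℂ) • x.complexify := by
  ext <;> simp [-Complex.coe_smul]

theorem complexify_mul (x y : Oct ℝ) : (x * y).complexify = x.complexify * y.complexify := by
  ext <;> simp

theorem complexify_star (x : Oct ℝ) : (star x).complexify = star x.complexify := by
  ext <;> simp

/-- The Euclidean inner product `(x | y) = Re (x ȳ)` of real octonions. -/
def inner (x y : Oct ℝ) : ℝ := (x * star y).fst.re

theorem inner_add_left (x y z : Oct ℝ) : inner (x + y) z = inner x z + inner y z := by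
  simp [inner, add_mul]

theorem inner_add_right (x y z : Oct ℝ) : inner x (y + z) = inner x y + inner x z := by
  simp [inner, mul_add]

theorem inner_smul_left (r : ℝ) (x y : Oct ℝ) : inner (r • x) y = r * inner x y := by
  simp [inner]; ring

theorem inner_smul_right (r : ℝ) (x y : Oct ℝ) : inner x (r • y) = r * inner x y := by
  simp [inner]; ring

theorem inner_eq (x y : Oct ℝ) : (2 * inner x y : ℂ) • (1 : Oct ℂ) =
    x.complexify * star y.complexify + y.complexify * star x.complexify := by
  ext <;> simp [inner] <;> ring

theorem inner_eq' (x y : Oct ℝ) : (2 * inner x y : ℂ) • (1 : Oct ℂ) =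
    star x.complexify * y.complexify + star y.complexify * x.complexify := by
  ext <;> simp [inner] <;> ring

end Oct

/-- The exceptional Jordan algebra: the element `⟨ξ₁, ξ₂, ξ₃, x₁, x₂, x₃⟩` stands for the matrix
`h¹(ξ₁, ξ₂, ξ₃; x₁, x₂, x₃)`, which is `J1.toMatrix` below. -/
@[ext]
structure J1 where
  /-- first diagonal entry -/
  ξ₁ : ℝ
  /-- second diagonal entry -/
  ξ₂ : ℝ
  /-- third diagonal entry -/
  ξ₃ : ℝ
  /-- octonion of the entry in position `(2, 3)` -/
  x₁ : Oct ℝ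
  /-- octonion of the entry in position `(3, 1)` -/
  x₂ : Oct ℝ
  /-- octonion of the entry in position `(1, 2)` -/
  x₃ : Oct ℝ

namespace J1

instance : Zero J1 := ⟨⟨0, 0, 0, 0, 0, 0⟩⟩
instance : Add J1 :=
  ⟨fun X Y => ⟨X.ξ₁ + Y.ξ₁, X.ξ₂ + Y.ξ₂, X.ξ₃ + Y.ξ₃, X.x₁ + Y.x₁, X.x₂ + Y.x₂, X.x₃ + Y.x₃⟩⟩
instance : Neg J1 := ⟨fun X => ⟨-X.ξ₁, -X.ξ₂, -X.ξ₃, -X.x₁, -X.x₂, -X.x₃⟩⟩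
instance : Sub J1 :=
  ⟨fun X Y => ⟨X.ξ₁ - Y.ξ₁, X.ξ₂ - Y.ξ₂, X.ξ₃ - Y.ξ₃, X.x₁ - Y.x₁, X.x₂ - Y.x₂, X.x₃ - Y.x₃⟩⟩
instance : SMul ℝ J1 :=
  ⟨fun r X => ⟨r * X.ξ₁, r * X.ξ₂, r * X.ξ₃, r • X.x₁, r • X.x₂, r • X.x₃⟩⟩

section
variable (r : ℝ) (X Y : J1)
@[simp] theorem ξ₁_zero : (0 : J1).ξ₁ = 0 := rfl
@[simp] theorem ξ₂_zero : (0 : J1).ξ₂ = 0 := rfl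
@[simp] theorem ξ₃_zero : (0 : J1).ξ₃ = 0 := rfl
@[simp] theorem x₁_zero : (0 : J1).x₁ = 0 := rfl
@[simp] theorem x₂_zero : (0 : J1).x₂ = 0 := rfl
@[simp] theorem x₃_zero : (0 : J1).x₃ = 0 := rfl
@[simp] theorem ξ₁_add : (X + Y).ξ₁ = X.ξ₁ + Y.ξ₁ := rfl
@[simp] theorem ξ₂_add : (X + Y).ξ₂ = X.ξ₂ + Y.ξ₂ := rfl
@[simp] theorem ξ₃_add : (X + Y).ξ₃ = X.ξ₃ + Y.ξ₃ := rfl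
@[simp] theorem x₁_add : (X + Y).x₁ = X.x₁ + Y.x₁ := rfl
@[simp] theorem x₂_add : (X + Y).x₂ = X.x₂ + Y.x₂ := rfl
@[simp] theorem x₃_add : (X + Y).x₃ = X.x₃ + Y.x₃ := rfl
@[simp] theorem ξ₁_neg : (-X).ξ₁ = -X.ξ₁ := rfl
@[simp] theorem ξ₂_neg : (-X).ξ₂ = -X.ξ₂ := rfl
@[simp] theorem ξ₃_neg : (-X).ξ₃ = -X.ξ₃ := rfl
@[simp] theorem x₁_neg : (-X).x₁ = -X.x₁ := rfl
@[simp] theorem x₂_neg : (-X).x₂ = -X.x₂ := rfl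
@[simp] theorem x₃_neg : (-X).x₃ = -X.x₃ := rfl
@[simp] theorem ξ₁_sub : (X - Y).ξ₁ = X.ξ₁ - Y.ξ₁ := rfl
@[simp] theorem ξ₂_sub : (X - Y).ξ₂ = X.ξ₂ - Y.ξ₂ := rfl
@[simp] theorem ξ₃_sub : (X - Y).ξ₃ = X.ξ₃ - Y.ξ₃ := rfl
@[simp] theorem x₁_sub : (X - Y).x₁ = X.x₁ - Y.x₁ := rfl
@[simp] theorem x₂_sub : (X - Y).x₂ = X.x₂ - Y.x₂ := rfl
@[simp] theorem x₃_sub : (X - Y).x₃ = X.x₃ - Y.x₃ := rfl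
@[simp] theorem ξ₁_smul : (r • X).ξ₁ = r * X.ξ₁ := rfl
@[simp] theorem ξ₂_smul : (r • X).ξ₂ = r * X.ξ₂ := rfl
@[simp] theorem ξ₃_smul : (r • X).ξ₃ = r * X.ξ₃ := rfl
@[simp] theorem x₁_smul : (r • X).x₁ = r • X.x₁ := rfl
@[simp] theorem x₂_smul : (r • X).x₂ = r • X.x₂ := rfl
@[simp] theorem x₃_smul : (r • X).x₃ = r • X.x₃ := rfl
end

instance : AddCommGroup J1 where
  add_assoc X Y Z := by ext1 <;> simp [add_assoc]
  zero_add X := by ext1 <;> simp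
  add_zero X := by ext1 <;> simp
  add_comm X Y := by ext1 <;> simp [add_comm]
  neg_add_cancel X := by ext1 <;> simp
  sub_eq_add_neg X Y := by ext1 <;> simp [sub_eq_add_neg]
  nsmul := nsmulRec
  zsmul := zsmulRec

instance : Module ℝ J1 where
  one_smul X := by ext1 <;> simp
  mul_smul r s X := by ext1 <;> simp [mul_smul, mul_assoc]
  smul_zero r := by ext1 <;> simp
  smul_add r X Y := by ext1 <;> simp [mul_add]
  add_smul r s X := by ext1 <;> simp [add_smul, add_mul]
  zero_smul X := by ext1 <;> simp

/-- The six coordinates of an element. -/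
def toProd : J1 ≃ₗ[ℝ] ℝ × ℝ × ℝ × Oct ℝ × Oct ℝ × Oct ℝ where
  toFun X := (X.ξ₁, X.ξ₂, X.ξ₃, X.x₁, X.x₂, X.x₃)
  invFun p := ⟨p.1, p.2.1, p.2.2.1, p.2.2.2.1, p.2.2.2.2.1, p.2.2.2.2.2⟩
  map_add' _ _ := rfl
  map_smul' _ _ := rfl

/- The norm serves only to give a meaning to the exponential series on the endomorphisms; all norms
on this finite-dimensional space are equivalent. -/
instance : NormedAddCommGroup J1 :=
  NormedAddCommGroup.induced J1 (ℝ × ℝ × ℝ × Oct ℝ × Oct ℝ × Oct ℝ) toProd toProd.injective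

instance : NormedSpace ℝ J1 :=
  NormedSpace.induced ℝ J1 (ℝ × ℝ × ℝ × Oct ℝ × Oct ℝ × Oct ℝ) toProd

instance : FiniteDimensional ℝ J1 := toProd.symm.finiteDimensional

/-- The Jordan product `X ∘ Y` in coordinates; see `J1.two_smul_toMatrix_jmul`. -/
def jmul (X Y : J1) : J1 where
  ξ₁ := X.ξ₁ * Y.ξ₁ - Oct.inner X.x₂ Y.x₂ - Oct.inner X.x₃ Y.x₃
  ξ₂ := X.ξ₂ * Y.ξ₂ + Oct.inner X.x₁ Y.x₁ - Oct.inner X.x₃ Y.x₃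
  ξ₃ := X.ξ₃ * Y.ξ₃ + Oct.inner X.x₁ Y.x₁ - Oct.inner X.x₂ Y.x₂
  x₁ := (2⁻¹ : ℝ) • ((X.ξ₂ + X.ξ₃) • Y.x₁ + (Y.ξ₂ + Y.ξ₃) • X.x₁
    - star (X.x₂ * Y.x₃ + Y.x₂ * X.x₃))
  x₂ := (2⁻¹ : ℝ) • ((X.ξ₁ + X.ξ₃) • Y.x₂ + (Y.ξ₁ + Y.ξ₃) • X.x₂
    + star (X.x₃ * Y.x₁ + Y.x₃ * X.x₁))
  x₃ := (2⁻¹ : ℝ) • ((X.ξ₁ + X.ξ₂) • Y.x₃ + (Y.ξ₁ + Y.ξ₂) • X.x₃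
    + star (X.x₁ * Y.x₂ + Y.x₁ * X.x₂))

/-- The matrix
`(ξ₁, i x₃, i x̄₂; i x̄₃, ξ₂, x₁; i x₂, x̄₁, ξ₃)` over the complexified octonions, `i = √-1`. -/
def toMatrix (X : J1) : Matrix (Fin 3) (Fin 3) (Oct ℂ) :=
  !![Oct.ofScalar X.ξ₁, Complex.I • X.x₃.complexify, Complex.I • (star X.x₂).complexify;
    Complex.I • (star X.x₃).complexify, Oct.ofScalar X.ξ₂, X.x₁.complexify;
    Complex.I • X.x₂.complexify, (star X.x₁).complexify, Oct.ofScalar X.ξ₃]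

end J1

/-- The Jordan product of `J1` is `X ∘ Y = 2⁻¹ (X Y + Y X)`, computed with the matrix product. -/
theorem J1.two_smul_toMatrix_jmul (X Y : J1) :
    (2 : ℂ) • (J1.jmul X Y).toMatrix = X.toMatrix * Y.toMatrix + Y.toMatrix * X.toMatrix := by
  have h1 := Oct.inner_eq X.x₁ Y.x₁
  have h2 := Oct.inner_eq X.x₂ Y.x₂
  have h3 := Oct.inner_eq X.x₃ Y.x₃
  have h1' := Oct.inner_eq' X.x₁ Y.x₁
  have h2' := Oct.inner_eq' X.x₂ Y.x₂
  have h3' := Oct.inner_eq' X.x₃ Y.x₃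
  ext1 i j
  fin_cases i <;> fin_cases j <;>
    simp only [J1.toMatrix, J1.jmul, Matrix.smul_apply, Matrix.add_apply, Matrix.mul_apply,
      Fin.sum_univ_three, Matrix.of_apply, Matrix.cons_val', Matrix.cons_val_zero,
      Matrix.cons_val_one, Matrix.cons_val, Fin.zero_eta, Fin.mk_one, Fin.reduceFinMk,
      Oct.ofScalar, Oct.complexify_add, Oct.complexify_sub, Oct.complexify_smul,
      Oct.complexify_mul, Oct.complexify_star, smul_smul, Oct.mul_smul', Oct.smul_mul',
      Oct.star_smul', star_add, star_sub, star_mul, star_star, one_mul, mul_one,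
      Complex.I_mul_I, Complex.ofReal_add, Complex.ofReal_sub, Complex.ofReal_mul,
      Complex.ofReal_inv, Complex.ofReal_ofNat]
  · linear_combination (norm := module) -h2' - h3
  · module
  · module
  · module
  · linear_combination (norm := module) h1 - h3'
  · module
  · module
  · module
  · linear_combination (norm := module) h1' - h2

namespace J1

/-- The Jordan product as a bilinear map. -/
def jmulB : J1 →ₗ[ℝ] J1 →ₗ[ℝ] J1 :=
  LinearMap.mk₂ ℝ jmul
    (fun X X' Y => by
      ext1 <;> simp [jmul, Oct.inner_add_left, add_mul] <;> first | ring1 | module)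
    (fun c X Y => by
      ext1 <;> simp [jmul, Oct.inner_smul_left, Oct.smul_mul', Oct.mul_smul', Oct.star_smul'] <;>
        first | ring1 | module)
    (fun X Y Y' => by
      ext1 <;> simp [jmul, Oct.inner_add_right, add_mul, mul_add] <;> first | ring1 | module)
    (fun c X Y => by
      ext1 <;> simp [jmul, Oct.inner_smul_right, Oct.smul_mul', Oct.mul_smul', Oct.star_smul'] <;>
        first | ring1 | module)

@[simp] theorem jmulB_apply (X Y : J1) : jmulB X Y = jmul X Y := rfl

end J1

/-- The group `F₄₍₋₂₀₎` of all `g ∈ GL_ℝ(J1)` with `g (X ∘ Y) = g X ∘ g Y`. -/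
def F4 : Subgroup (J1 ≃ₗ[ℝ] J1) where
  carrier := {g | ∀ X Y : J1, g (J1.jmul X Y) = J1.jmul (g X) (g Y)}
  one_mem' _ _ := rfl
  mul_mem' {g h} hg hh X Y := by
    rw [LinearEquiv.mul_apply, LinearEquiv.mul_apply, LinearEquiv.mul_apply, hh X Y]
    exact hg _ _
  inv_mem' {g} hg X Y := by
    apply g.injective
    have h := hg (g⁻¹ X) (g⁻¹ Y)
    simp only [← LinearEquiv.mul_apply, mul_inv_cancel] at h ⊢
    exact h.symm

theorem F4.map_jmul (g : F4) (X Y : J1) :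
    (g : J1 ≃ₗ[ℝ] J1) (J1.jmul X Y) =
      J1.jmul ((g : J1 ≃ₗ[ℝ] J1) X) ((g : J1 ≃ₗ[ℝ] J1) Y) := g.2 X Y

/-- The endomorphism of `J1` underlying an element of the group. -/
def F4.toEnd (g : F4) : Module.End ℝ J1 := ((g : J1 ≃ₗ[ℝ] J1) : J1 →ₗ[ℝ] J1)

/-- `Ad g : φ ↦ g φ g⁻¹` on the endomorphisms of `J1`. -/
def Ad (g : F4) : Module.End ℝ J1 ≃ₗ[ℝ] Module.End ℝ J1 := (g : J1 ≃ₗ[ℝ] J1).conj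

theorem Ad_apply_apply (g : F4) (φ : Module.End ℝ J1) (X : J1) :
    Ad g φ X = (g : J1 ≃ₗ[ℝ] J1) (φ ((g : J1 ≃ₗ[ℝ] J1).symm X)) := rfl

theorem Ad_one (φ : Module.End ℝ J1) : Ad 1 φ = φ := rfl

theorem Ad_mul (g h : F4) (φ : Module.End ℝ J1) : Ad (g * h) φ = Ad g (Ad h φ) := rfl

theorem Ad_inv_Ad (g : F4) (φ : Module.End ℝ J1) : Ad g⁻¹ (Ad g φ) = φ := by
  rw [← Ad_mul, inv_mul_cancel, Ad_one]

theorem Ad_Ad_inv (g : F4) (φ : Module.End ℝ J1) : Ad g (Ad g⁻¹ φ) = φ := by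
  rw [← Ad_mul, mul_inv_cancel, Ad_one]

theorem Ad_lie (g : F4) (φ ψ : Module.End ℝ J1) : Ad g ⁅φ, ψ⁆ = ⁅Ad g φ, Ad g ψ⁆ := by
  ext1 X
  simp [Ad_apply_apply, Ring.lie_def]

/-- The linear map underlying `σ`:
`h¹(ξ₁, ξ₂, ξ₃; x₁, x₂, x₃) ↦ h¹(ξ₁, ξ₂, ξ₃; x₁, -x₂, -x₃)`. -/
def sigmaLin : J1 →ₗ[ℝ] J1 where
  toFun X := ⟨X.ξ₁, X.ξ₂, X.ξ₃, X.x₁, -X.x₂, -X.x₃⟩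
  map_add' X Y := by ext1 <;> simp [add_comm]
  map_smul' r X := by ext1 <;> simp

theorem sigmaLin_sigmaLin (X : J1) : sigmaLin (sigmaLin X) = X := by
  ext1 <;> simp [sigmaLin]

theorem sigmaLin_jmul (X Y : J1) :
    sigmaLin (J1.jmul X Y) = J1.jmul (sigmaLin X) (sigmaLin Y) := by
  ext1 <;> simp [sigmaLin, J1.jmul, Oct.inner] <;> abel

/-- The element `σ` of the group. -/
def sigma : F4 := ⟨LinearEquiv.ofInvolutive sigmaLin sigmaLin_sigmaLin, sigmaLin_jmul⟩

/-- The endomorphism `Ã₃¹(a)` of `J1`; see `toMatrix_A3`. -/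
def A3 (a : Oct ℝ) : Module.End ℝ J1 where
  toFun X := ⟨-2 * Oct.inner a X.x₃, 2 * Oct.inner a X.x₃, 0, star (X.x₂ * a), star (a * X.x₁),
    (X.ξ₂ - X.ξ₁) • a⟩
  map_add' X Y := by
    ext1 <;> simp [Oct.inner_add_right, add_mul, mul_add] <;> first | ring1 | module
  map_smul' r X := by
    ext1 <;> simp [Oct.inner_smul_right, Oct.smul_mul', Oct.mul_smul', Oct.star_smul'] <;>
      first | ring1 | module

/-- `Ã₃¹(a)` is the commutator with the matrix `(0, i a, 0; -i ā, 0, 0; 0, 0, 0)`. -/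
theorem toMatrix_A3 (a : Oct ℝ) (X : J1) :
    let T : Matrix (Fin 3) (Fin 3) (Oct ℂ) :=
      !![0, Complex.I • a.complexify, 0; -Complex.I • (star a).complexify, 0, 0; 0, 0, 0]
    (A3 a X).toMatrix = T * X.toMatrix - X.toMatrix * T := by
  intro T
  have h3 := Oct.inner_eq a X.x₃
  have h3' := Oct.inner_eq' a X.x₃
  ext1 i j
  fin_cases i <;> fin_cases j <;>
    simp only [J1.toMatrix, A3, LinearMap.coe_mk, AddHom.coe_mk, T, Matrix.sub_apply,
      Matrix.mul_apply,
      Fin.sum_univ_three, Matrix.of_apply, Matrix.cons_val', Matrix.cons_val_zero,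
      Matrix.cons_val_one, Matrix.cons_val, Fin.zero_eta, Fin.mk_one, Fin.reduceFinMk,
      Oct.ofScalar, Oct.complexify_smul,
      Oct.complexify_mul, Oct.complexify_star, smul_smul, Oct.mul_smul', Oct.smul_mul',
      Oct.star_smul', star_mul, star_star, one_mul, mul_one,
      Complex.I_mul_I, Complex.ofReal_sub, Complex.ofReal_mul, Complex.ofReal_neg,
      Complex.ofReal_ofNat, Complex.ofReal_zero, zero_mul, mul_zero, neg_mul, mul_neg]
  · linear_combination (norm := module) -h3
  · module
  · module
  · module
  · linear_combination (norm := module) h3'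
  · module
  · module
  · module
  · module

/-- The exponential of an endomorphism of `J1`. -/
def expEnd (φ : Module.End ℝ J1) : Module.End ℝ J1 :=
  (Module.End.toContinuousLinearMap J1).symm
    (NormedSpace.exp (Module.End.toContinuousLinearMap J1 φ))

theorem expEnd_eq (φ : Module.End ℝ J1) (X : J1) :
    expEnd φ X = NormedSpace.exp (Module.End.toContinuousLinearMap J1 φ) X := rfl

theorem expEnd_Ad (g : F4) (φ : Module.End ℝ J1) : expEnd (Ad g φ) = Ad g (expEnd φ) := by
  let _ : NormedAlgebra ℚ (J1 →L[ℝ] J1) := NormedAlgebra.restrictScalars ℚ ℝ _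
  let c : (J1 →L[ℝ] J1) ≃ₐ[ℝ] (J1 →L[ℝ] J1) :=
    ((Module.End.toContinuousLinearMap J1).symm.trans
      ((g : J1 ≃ₗ[ℝ] J1).conjAlgEquiv ℝ)).trans (Module.End.toContinuousLinearMap J1)
  have hc : Continuous c := c.toLinearMap.continuous_of_finiteDimensional
  have h := NormedSpace.map_exp c hc (Module.End.toContinuousLinearMap J1 φ)
  have h' := congrArg (Module.End.toContinuousLinearMap J1).symm h
  exact h'.symm

/-- `exp (t φ)` is an automorphism for all `t` if and only if `φ` is a derivation. -/
theorem exp_mem_iff (φ : Module.End ℝ J1) :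
    (∀ t : ℝ, ∃ g : F4, F4.toEnd g = expEnd (t • φ)) ↔
      ∀ X Y : J1, φ (J1.jmul X Y) = J1.jmul (φ X) Y + J1.jmul X (φ Y) := by
  let _ : NormedAlgebra ℚ (J1 →L[ℝ] J1) := NormedAlgebra.restrictScalars ℚ ℝ _
  let B := J1.jmulB.toContinuousBilinearMap
  let D := Module.End.toContinuousLinearMap J1 φ
  have hB : ∀ X Y, B X Y = J1.jmul X Y := fun X Y => rfl
  have hD : ∀ t X, expEnd (t • φ) X = NormedSpace.exp (t • D) X := fun t X => by
    rw [expEnd_eq, map_smul]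
  have hd : ∀ (t : ℝ) (X : J1), HasDerivAt (fun s : ℝ => NormedSpace.exp (s • D) X)
      (D (NormedSpace.exp (t • D) X)) t := fun t X => by
    have := (hasDerivAt_exp_smul_const' (𝕂 := ℝ) D t).clm_apply (hasDerivAt_const t X)
    simpa using this
  have hd' : ∀ (t : ℝ) (X Y : J1),
      HasDerivAt (fun s : ℝ => B (NormedSpace.exp (s • D) X) (NormedSpace.exp (s • D) Y))
        (B (NormedSpace.exp (t • D) X) (D (NormedSpace.exp (t • D) Y)) +
          B (D (NormedSpace.exp (t • D) X)) (NormedSpace.exp (t • D) Y)) t := fun t X Y => by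
    have := B.hasFDerivAt_of_bilinear (hd t X).hasFDerivAt (hd t Y).hasFDerivAt
    simpa [hasDerivAt_iff_hasFDerivAt] using this.hasDerivAt
  constructor
  · intro h X Y
    have h1 := hd' 0 X Y
    have h2 : (fun s : ℝ => B (NormedSpace.exp (s • D) X) (NormedSpace.exp (s • D) Y)) =
        fun s : ℝ => NormedSpace.exp (s • D) (J1.jmul X Y) := by
      funext s
      obtain ⟨g, hg⟩ := h s
      have hg' : ∀ Z, NormedSpace.exp (s • D) Z = (g : J1 ≃ₗ[ℝ] J1) Z := fun Z => by
        rw [← hD, ← hg]; rfl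
      rw [hg', hg', hg', hB, ← F4.map_jmul]
    rw [h2] at h1
    have h3 := (hd 0 (J1.jmul X Y)).unique h1
    simp only [zero_smul, NormedSpace.exp_zero, one_apply_eq_self, hB] at h3
    rw [add_comm]
    exact h3
  · intro h t
    have hinv : ∀ (s : ℝ) (Z : J1),
        NormedSpace.exp (s • D) (NormedSpace.exp (-s • D) Z) = Z := fun s Z => by
      rw [← mul_apply_eq_comp, ← NormedSpace.exp_add_of_commute
        (((Commute.refl D).smul_left s).smul_right (-s))]
      simp
    have hinv' : ∀ (s : ℝ) (Z : J1),
        NormedSpace.exp (-s • D) (NormedSpace.exp (s • D) Z) = Z := fun s Z => by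
      simpa using hinv (-s) Z
    have key : ∀ X Y : J1, NormedSpace.exp (t • D) (J1.jmul X Y) =
        J1.jmul (NormedSpace.exp (t • D) X) (NormedSpace.exp (t • D) Y) := by
      intro X Y
      let f : ℝ → J1 := fun s => NormedSpace.exp (-s • D)
        (B (NormedSpace.exp (s • D) X) (NormedSpace.exp (s • D) Y))
      have hf : ∀ s, HasDerivAt f 0 s := fun s => by
        have e1 : HasDerivAt (fun s : ℝ => NormedSpace.exp (-s • D))
            (-(NormedSpace.exp (-s • D) * D)) s := by
          have := (hasDerivAt_exp_smul_const (𝕂 := ℝ) D (-s)).scomp s (hasDerivAt_neg s)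
          simpa [Function.comp_def] using this
        have e2 := e1.clm_apply (hd' s X Y)
        refine e2.congr_deriv ?_
        have hh : D (J1.jmul (NormedSpace.exp (s • D) X) (NormedSpace.exp (s • D) Y)) =
            _ := h (NormedSpace.exp (s • D) X) (NormedSpace.exp (s • D) Y)
        rw [neg_apply, mul_apply_eq_comp, hB, hB, hB, hh,
          neg_add_eq_zero, add_comm]
        rfl
      have hconst := is_const_of_deriv_eq_zero (fun s => (hf s).differentiableAt)
        (fun s => (hf s).deriv) t 0
      have : NormedSpace.exp (-t • D)
          (J1.jmul (NormedSpace.exp (t • D) X) (NormedSpace.exp (t • D) Y)) = J1.jmul X Y := by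
        simpa [f, hB] using hconst
      rw [← this, hinv]
    refine ⟨⟨LinearEquiv.ofLinearMap (expEnd (t • φ)) (expEnd (-t • φ)) ?_ ?_, ?_⟩, ?_⟩
    · ext1 Z
      exact (congrArg _ (hD _ _)).trans ((hD _ _).trans (hinv t Z))
    · ext1 Z
      exact (congrArg _ (hD _ _)).trans ((hD _ _).trans (hinv' t Z))
    · intro X Y
      exact (hD _ _).trans ((key X Y).trans (by rw [← hD, ← hD]; rfl))
    · rfl

/-- The Lie algebra of the closed linear group `F₄₍₋₂₀₎`: the endomorphisms `φ` of `J1` with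
`exp (t φ)` in the group for all real `t`, with the commutator bracket. -/
def f4 : Submodule ℝ (Module.End ℝ J1) where
  carrier := {φ | ∀ t : ℝ, ∃ g : F4, F4.toEnd g = expEnd (t • φ)}
  zero_mem' := by
    refine (exp_mem_iff _).2 fun X Y => ?_
    simp [← J1.jmulB_apply]
  add_mem' {φ ψ} hφ hψ := by
    refine (exp_mem_iff _).2 fun X Y => ?_
    have h1 := (exp_mem_iff _).1 hφ X Y
    have h2 := (exp_mem_iff _).1 hψ X Y
    simp only [← J1.jmulB_apply] at h1 h2 ⊢
    simp only [LinearMap.add_apply, h1, h2, map_add]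
    abel
  smul_mem' c φ hφ := by
    refine (exp_mem_iff _).2 fun X Y => ?_
    have h1 := (exp_mem_iff _).1 hφ X Y
    simp only [← J1.jmulB_apply] at h1 ⊢
    simp only [LinearMap.smul_apply, map_smul, h1, smul_add]

theorem lie_mem_f4 {φ ψ : Module.End ℝ J1} (hφ : φ ∈ f4) (hψ : ψ ∈ f4) : ⁅φ, ψ⁆ ∈ f4 := by
  refine (exp_mem_iff _).2 fun X Y => ?_
  have h1 := (exp_mem_iff _).1 hφ
  have h2 := (exp_mem_iff _).1 hψ
  simp only [← J1.jmulB_apply] at h1 h2 ⊢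
  simp only [Ring.lie_def, LinearMap.sub_apply, Module.End.mul_apply, h1, h2, map_add, map_sub]
  abel

theorem Ad_mem_f4 (g : F4) {φ : Module.End ℝ J1} (hφ : φ ∈ f4) : Ad g φ ∈ f4 := by
  intro t
  obtain ⟨h, hh⟩ := hφ t
  refine ⟨g * h * g⁻¹, ?_⟩
  rw [← map_smul, expEnd_Ad, ← hh]
  rfl

/-- The Cartan involution `θ = dσ̃`, that is `θ φ = σ φ σ⁻¹`. -/
def theta : Module.End ℝ J1 ≃ₗ[ℝ] Module.End ℝ J1 := Ad sigma

/-- `𝔨 = {φ ∈ 𝔣₄₍₋₂₀₎ | θ φ = φ}`. -/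
def kAlg : Submodule ℝ (Module.End ℝ J1) where
  carrier := {φ | φ ∈ f4 ∧ theta φ = φ}
  zero_mem' := ⟨zero_mem _, map_zero _⟩
  add_mem' := fun ⟨h, h'⟩ ⟨k, k'⟩ => ⟨add_mem h k, by rw [map_add, h', k']⟩
  smul_mem' := fun c _ ⟨h, h'⟩ => ⟨f4.smul_mem c h, by rw [map_smul, h']⟩

/-- `𝔞 = {t Ã₃¹(1) | t ∈ ℝ}`. -/
abbrev aAlg : Submodule ℝ (Module.End ℝ J1) := Submodule.span ℝ {A3 1}

/-- `𝔪 = {φ ∈ 𝔨 | [φ, Ã₃¹(1)] = 0}`. -/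
def mAlg : Submodule ℝ (Module.End ℝ J1) where
  carrier := {φ | φ ∈ kAlg ∧ ⁅φ, A3 1⁆ = 0}
  zero_mem' := ⟨zero_mem _, by simp [Ring.lie_def]⟩
  add_mem' := fun ⟨h, h'⟩ ⟨k, k'⟩ => ⟨add_mem h k, by
    rw [Ring.lie_def] at h' k' ⊢
    rw [add_mul, mul_add, add_sub_add_comm, h', k', add_zero]⟩
  smul_mem' := fun c _ ⟨h, h'⟩ => ⟨kAlg.smul_mem c h, by
    rw [Ring.lie_def] at h' ⊢
    rw [smul_mul_assoc, mul_smul_comm, ← smul_sub, h', smul_zero]⟩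

/-- `𝔤_λ = {φ ∈ 𝔣₄₍₋₂₀₎ | [H, φ] = λ(H) φ for all H ∈ 𝔞}`. -/
def rootSpace (l : Module.Dual ℝ aAlg) : Submodule ℝ (Module.End ℝ J1) where
  carrier := {φ | φ ∈ f4 ∧ ∀ H : aAlg, ⁅(H : Module.End ℝ J1), φ⁆ = l H • φ}
  zero_mem' := ⟨zero_mem _, fun H => by simp [Ring.lie_def]⟩
  add_mem' := fun ⟨h, h'⟩ ⟨k, k'⟩ =>
    ⟨add_mem h k, fun H => by
      have h1 := h' H
      have h2 := k' H
      rw [Ring.lie_def] at h1 h2 ⊢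
      rw [add_mul, mul_add, add_sub_add_comm, h1, h2, smul_add]⟩
  smul_mem' := fun c _ ⟨h, h'⟩ =>
    ⟨f4.smul_mem c h, fun H => by
      have h1 := h' H
      rw [Ring.lie_def] at h1 ⊢
      rw [smul_mul_assoc, mul_smul_comm, ← smul_sub, h1, smul_comm]⟩

/-- The set `Σ` of roots of `(𝔣₄₍₋₂₀₎, 𝔞)`. -/
def roots : Set (Module.Dual ℝ aAlg) := {l | l ≠ 0 ∧ rootSpace l ≠ ⊥}

theorem A3_one_ne_zero : A3 1 ≠ 0 := by
  intro h
  have := congrArg (fun φ : Module.End ℝ J1 => (φ ⟨1, 0, 0, 0, 0, 0⟩).x₃.fst.re) h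
  simp [A3] at this

/-- The linear functional `α` on `𝔞` with `α(Ã₃¹(1)) = 1`. -/
def alpha : Module.Dual ℝ aAlg :=
  (LinearEquiv.coord ℝ (Module.End ℝ J1) (A3 1) A3_one_ne_zero : aAlg →ₗ[ℝ] ℝ)

theorem alpha_A3_one : alpha ⟨A3 1, Submodule.mem_span_singleton_self _⟩ = 1 :=
  LinearEquiv.coord_self ℝ (Module.End ℝ J1) (A3 1) A3_one_ne_zero

open Classical in
/-- The signature of roots: `ε(±α) = -1` and `ε(±2α) = 1`
(the values outside the set of roots are never used). -/
def eps (l : Module.Dual ℝ aAlg) : ℝ := if l = alpha ∨ l = -alpha then -1 else 1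

/-- The graph of the linear map `θ_ε` of `𝔣₄₍₋₂₀₎` which is `ε(λ) θ` on `𝔤_λ` for every root `λ` and
`θ` on `𝔞 ⊕ 𝔪`, where `𝔣₄₍₋₂₀₎` is the direct sum of `𝔞 ⊕ 𝔪` and the root spaces. -/
def thetaEpsGraph : Submodule ℝ (Module.End ℝ J1 × Module.End ℝ J1) :=
  Submodule.span ℝ
    ({q | ∃ l ∈ roots, q.1 ∈ rootSpace l ∧ q.2 = eps l • theta q.1} ∪
      {q | q.1 ∈ aAlg ⊔ mAlg ∧ q.2 = theta q.1})

/-- `𝔨_ε = {φ ∈ 𝔣₄₍₋₂₀₎ | θ_ε φ = φ}`. -/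
def kEps : Submodule ℝ (Module.End ℝ J1) where
  carrier := {φ | φ ∈ f4 ∧ (φ, φ) ∈ thetaEpsGraph}
  zero_mem' := ⟨zero_mem _, zero_mem _⟩
  add_mem' := fun ⟨h, h'⟩ ⟨k, k'⟩ => ⟨add_mem h k, add_mem h' k'⟩
  smul_mem' := fun c _ ⟨h, h'⟩ => ⟨f4.smul_mem c h, thetaEpsGraph.smul_mem c h'⟩

/-- `K`, the subgroup of the fixed points of `σ̃ : g ↦ σ g σ⁻¹`. -/
def K : Subgroup F4 where
  carrier := {g | sigma * g * sigma⁻¹ = g}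
  one_mem' := by simp
  mul_mem' {g h} hg hh := by
    change sigma * (g * h) * sigma⁻¹ = g * h
    rw [← show sigma * g * sigma⁻¹ = g from hg, ← show sigma * h * sigma⁻¹ = h from hh]
    nth_rewrite 1 [show sigma * g * sigma⁻¹ = g from hg, show sigma * h * sigma⁻¹ = h from hh]
    group
  inv_mem' {g} hg := by
    change sigma * g⁻¹ * sigma⁻¹ = g⁻¹
    nth_rewrite 2 [← show sigma * g * sigma⁻¹ = g from hg]
    group

/-- `M`, the centralizer of `𝔞` in `K`: the `k ∈ K` with `k Ã₃¹(1) k⁻¹ = Ã₃¹(1)`. -/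
def M : Subgroup F4 where
  carrier := {k | k ∈ K ∧ Ad k (A3 1) = A3 1}
  one_mem' := ⟨one_mem _, rfl⟩
  mul_mem' := fun ⟨h, h'⟩ ⟨k, k'⟩ => ⟨mul_mem h k, by rw [Ad_mul, k', h']⟩
  inv_mem' := fun {k} ⟨h, h'⟩ => ⟨inv_mem h, by
    have := Ad_inv_Ad k (A3 1)
    rwa [h'] at this⟩

/-- `M^*`, the normalizer of `𝔞` in `K`: the `k ∈ K` with `k 𝔞 k⁻¹ = 𝔞`. -/
def Mstar : Subgroup F4 where
  carrier := {k | k ∈ K ∧ Ad k '' (aAlg : Set (Module.End ℝ J1)) = aAlg}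
  one_mem' := ⟨one_mem _, by ext φ; simp [Ad_one]⟩
  mul_mem' := fun {k l} ⟨h, h'⟩ ⟨j, j'⟩ => ⟨mul_mem h j, by
    have : (Ad (k * l) : Module.End ℝ J1 → Module.End ℝ J1) = Ad k ∘ Ad l :=
      funext fun φ => Ad_mul k l φ
    rw [this, Set.image_comp, j', h']⟩
  inv_mem' := fun {k} ⟨h, h'⟩ => ⟨inv_mem h, by
    nth_rewrite 1 [← h']
    rw [← Set.image_comp]
    have : (Ad k⁻¹ ∘ Ad k : Module.End ℝ J1 → Module.End ℝ J1) = id :=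
      funext fun φ => Ad_inv_Ad k φ
    rw [this, Set.image_id]⟩

theorem Ad_of_mem_M {m : F4} (hm : m ∈ M) {H : Module.End ℝ J1} (hH : H ∈ aAlg) : Ad m H = H := by
  obtain ⟨t, rfl⟩ := Submodule.mem_span_singleton.1 hH
  rw [map_smul, hm.2]

theorem M_le_Mstar : M ≤ Mstar := fun m hm => ⟨hm.1, by
  rw [Set.image_congr fun H hH => Ad_of_mem_M hm hH, Set.image_id']⟩

instance : (M.subgroupOf Mstar).Normal where
  conj_mem n hn g := by
    have hn' : (n : F4) ∈ M := hn
    have hg := inv_mem g.2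
    refine ⟨mul_mem (mul_mem g.2.1 hn'.1) (inv_mem g.2.1), ?_⟩
    have h1 : Ad (g : F4)⁻¹ (A3 1) ∈ (aAlg : Set (Module.End ℝ J1)) := by
      rw [← hg.2]
      exact ⟨_, Submodule.mem_span_singleton_self _, rfl⟩
    change Ad ((g : F4) * n * (g : F4)⁻¹) (A3 1) = A3 1
    rw [Ad_mul, Ad_mul, Ad_of_mem_M hn' h1, Ad_Ad_inv]

/-- The Weyl group `W = M^* / M`. -/
abbrev W : Type := Mstar ⧸ M.subgroupOf Mstar

/-- `(K_ε)⁰`, the connected Lie subgroup with Lie algebra `𝔨_ε`, that is, the subgroup generated by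
`exp 𝔨_ε`. -/
def KEps0 : Subgroup F4 := Subgroup.closure {g | ∃ φ ∈ kEps, F4.toEnd g = expEnd φ}

theorem Ad_theta {m : F4} (hm : m ∈ M) (φ : Module.End ℝ J1) :
    Ad m (theta φ) = theta (Ad m φ) := by
  have h : sigma * m = m * sigma := mul_inv_eq_iff_eq_mul.1 hm.1
  rw [theta, ← Ad_mul, ← Ad_mul, h]

theorem Ad_mem_kEps {m : F4} (hm : m ∈ M) {φ : Module.End ℝ J1} (hφ : φ ∈ kEps) :
    Ad m φ ∈ kEps := by
  refine ⟨Ad_mem_f4 m hφ.1, ?_⟩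
  have key : thetaEpsGraph ≤ thetaEpsGraph.comap
      ((Ad m : Module.End ℝ J1 →ₗ[ℝ] Module.End ℝ J1).prodMap
        (Ad m : Module.End ℝ J1 →ₗ[ℝ] Module.End ℝ J1)) := by
    rw [thetaEpsGraph, Submodule.span_le]
    rintro ⟨φ, ψ⟩ (⟨l, hl, h1, h2⟩ | ⟨h1, h2⟩)
    · refine Submodule.subset_span (Or.inl ⟨l, hl, ⟨Ad_mem_f4 m h1.1, fun H => ?_⟩, ?_⟩)
      · have := congrArg (Ad m) (h1.2 H)
        rwa [Ad_lie, Ad_of_mem_M hm H.2, map_smul] at this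
      · have := congrArg (Ad m) h2
        rwa [map_smul, Ad_theta hm] at this
    · refine Submodule.subset_span (Or.inr ⟨?_, ?_⟩)
      · obtain ⟨y, hy, z, hz, hyz⟩ := Submodule.mem_sup.1 h1
        refine Submodule.mem_sup.2 ⟨y, hy, Ad m z, ⟨⟨Ad_mem_f4 m hz.1.1, ?_⟩, ?_⟩, ?_⟩
        · rw [← Ad_theta hm, hz.1.2]
        · have := congrArg (Ad m) hz.2
          rwa [Ad_lie, hm.2, map_zero] at this
        · have := congrArg (Ad m) hyz
          rwa [map_add, Ad_of_mem_M hm hy] at this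
      · have := congrArg (Ad m) h2
        rwa [Ad_theta hm] at this
  exact key hφ.2

theorem M_le_normalizer : M ≤ Subgroup.normalizer (KEps0 : Set F4) := by
  have key : ∀ m ∈ M, ∀ g ∈ KEps0, m * g * m⁻¹ ∈ KEps0 := by
    intro m hm g hg
    have : KEps0 ≤ KEps0.comap (MulAut.conj m).toMonoidHom := by
      rw [KEps0, Subgroup.closure_le]
      rintro g ⟨φ, hφ, h⟩
      refine Subgroup.subset_closure ⟨Ad m φ, Ad_mem_kEps hm hφ, ?_⟩
      rw [expEnd_Ad, ← h]
      rfl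
    exact this hg
  intro m hm
  refine Subgroup.mem_normalizer_iff.2 fun g => ⟨key m hm g, fun h => ?_⟩
  have := key m⁻¹ (inv_mem hm) _ h
  simpa [mul_assoc] using this

/-- `K_ε = (K_ε)⁰ M`. It is a subgroup because `M` normalizes `(K_ε)⁰`. -/
def KEps : Subgroup F4 where
  carrier := {g | ∃ k ∈ KEps0, ∃ m ∈ M, k * m = g}
  one_mem' := ⟨1, one_mem _, 1, one_mem _, one_mul 1⟩
  mul_mem' := by
    rintro _ _ ⟨k, hk, m, hm, rfl⟩ ⟨k', hk', m', hm', rfl⟩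
    exact ⟨k * (m * k' * m⁻¹),
      mul_mem hk ((Subgroup.mem_normalizer_iff.1 (M_le_normalizer hm) k').1 hk'),
      m * m', mul_mem hm hm', by group⟩
  inv_mem' := by
    rintro _ ⟨k, hk, m, hm, rfl⟩
    exact ⟨m⁻¹ * k⁻¹ * m⁻¹⁻¹, (Subgroup.mem_normalizer_iff.1
      (M_le_normalizer (inv_mem hm)) k⁻¹).1 (inv_mem hk), m⁻¹, inv_mem hm, by group⟩

/-- `M_ε^* = K_ε ∩ M^*`. -/
def MstarEps : Subgroup F4 := KEps ⊓ Mstar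

theorem M_le_MstarEps : M ≤ MstarEps :=
  fun m hm => ⟨⟨1, one_mem _, m, hm, one_mul m⟩, M_le_Mstar hm⟩

/-- `W_ε = M_ε^* / M`, the subgroup of `W = M^* / M` of the cosets of `M` in `M_ε^*`. -/
def WEps : Subgroup W := (MstarEps.subgroupOf Mstar).map (QuotientGroup.mk' (M.subgroupOf Mstar))

end ExcF4

end

open ExcF4

open scoped Quaternion

noncomputable section

namespace ExcF4

/-! ### Octonion identities behind the derivation property -/

namespace Oct

/-! Write `A` for `A3 1`. Since `𝔞` is the line through `A`, an element `k` of `M^*` acts on it by a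
scalar `t`, and everything rests on two facts: `t = ±1`, and `-1` is already attained inside
`(K_ε)⁰`.

For the first, conjugation by `k` carries eigenvectors of `A` on `J1` to eigenvectors of `t A`. The
nonzero real eigenvalues of `A` have square `1` or `4`, and `2` occurs. Applying this to `k` and to
`k⁻¹` leaves only `t² = 1` (`eq_one_or_neg_one_of_Ad_A3_one`). As `σ` acts on `𝔞` by `-1`, either
`k` or `σk` centralizes `A`, and `σ` does not. This gives part (1).

For the second, choose an imaginary unit `e`. The derivations `A`, `E = A3 e` and `rot = ½[A, E]`
span a copy of `𝔰𝔩(2, ℝ)`, with `[A, rot] = 2E` and `[A, E] = 2 rot`. So `rot ± E` lie in the root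
spaces of `±2α`, where `ε = 1`, and `θ` interchanges them; their half sum `rot` is therefore fixed
by `θ_ε` (`rot_mem_kEps`). Since `ad rot` rotates the plane of `A` and `E` with speed `2`,
`exp((π/2) rot)` is an element `g` of `(K_ε)⁰ ∩ K` with `Ad g A = -A`. Then `σg ∈ M`, whence `σ ∈
(K_ε)⁰ M = K_ε`, and part (2) reduces to part (1). -/

theorem inner_comm (x y : Oct ℝ) : inner x y = inner y x := by
  simp [inner]; ring

theorem inner_star_star (x y : Oct ℝ) : inner (star x) (star y) = inner x y := by
  simp [inner]

/-- Although octonions are not associative, the real part of a triple product does not depend on the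
bracketing, and it is invariant under cyclic permutation. Combined with conjugation this gives the
present identity and the next one. -/
theorem inner_star_mul_star_left (x y z : Oct ℝ) :
    inner (star y * star x) z = inner x (star z * star y) := by
  simp [inner]; ring

theorem inner_star_mul_star_right (x y z : Oct ℝ) :
    inner (star x * star y) z = inner x (star y * star z) := by
  simp [inner]; ring

-- Polarization in `x` of `x̄(xy) = |x|² y`, the form in which alternativity enters.
set_option maxHeartbeats 800000 in
theorem star_mul_mul_add (a x y : Oct ℝ) :
    star a * (x * y) + star x * (a * y) = (2 * inner a x) • y := by
  ext <;> simp [inner] <;> ring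

theorem mul_mul_star_add (a x y : Oct ℝ) :
    (y * x) * star a + (y * a) * star x = (2 * inner a x) • y := by
  have h := congrArg star (star_mul_mul_add (star a) (star x) (star y))
  simpa only [star_add, star_mul, star_star, star_smul', inner_star_star, add_comm] using h

end Oct

/-! ### The derivations `Ã₃¹(a)` and the compact generator `rot` -/

/-- The endomorphisms `Ã₃¹(a)` are derivations of the Jordan algebra. -/
theorem A3_mem_f4 (a : Oct ℝ) : A3 a ∈ f4 := by
  refine (exp_mem_iff _).2 fun X Y => ?_
  obtain ⟨ξ₁, ξ₂, ξ₃, x₁, x₂, x₃⟩ := X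
  obtain ⟨η₁, η₂, η₃, y₁, y₂, y₃⟩ := Y
  ext1 <;> simp only [A3, J1.jmul, LinearMap.coe_mk, AddHom.coe_mk, J1.ξ₁_add, J1.ξ₂_add,
    J1.ξ₃_add, J1.x₁_add, J1.x₂_add, J1.x₃_add, star_add, star_neg, star_mul, star_star, add_mul,
    mul_add, neg_mul, Oct.smul_mul', Oct.mul_smul', Oct.star_smul', Oct.inner_smul_right,
    Oct.inner_smul_left, Oct.inner_add_right, sub_eq_add_neg]
  -- The three diagonal entries need only the cyclic invariance of the real part.
  · rw [Oct.inner_star_mul_star_left a, Oct.inner_comm x₂, Oct.inner_star_mul_star_left a,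
      Oct.inner_comm x₃ a]
    ring
  · rw [Oct.inner_star_mul_star_right a, Oct.inner_comm x₁, Oct.inner_star_mul_star_right a,
      Oct.inner_comm x₃ a]
    ring
  · rw [Oct.inner_star_mul_star_right a, Oct.inner_comm x₁, Oct.inner_star_mul_star_right a,
      Oct.inner_star_mul_star_left a, Oct.inner_comm x₂, Oct.inner_star_mul_star_left a]
    ring
  -- In the off-diagonal entries the triple products pair up into polarized norm identities. Their
  -- scalar terms match the diagonal entries of the images of `X` and `Y` or, in the last case, of
  -- `X ∘ Y`.
  · have h1 := Oct.star_mul_mul_add a x₃ y₁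
    have h2 := Oct.star_mul_mul_add a y₃ x₁
    linear_combination (norm := module) (2⁻¹ : ℝ) • h1 + (2⁻¹ : ℝ) • h2
  · have h1 := Oct.mul_mul_star_add a x₃ y₂
    have h2 := Oct.mul_mul_star_add a y₃ x₂
    linear_combination (norm := module) -(2⁻¹ : ℝ) • h1 - (2⁻¹ : ℝ) • h2
  · have h1 := Oct.star_mul_mul_add x₂ y₂ a
    have h2 := Oct.mul_mul_star_add y₁ x₁ a
    rw [Oct.inner_comm y₁ x₁] at h2
    linear_combination (norm := module) -(2⁻¹ : ℝ) • h1 - (2⁻¹ : ℝ) • h2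

/-- An imaginary unit `e` of the octonions. -/
def imUnit : Oct ℝ := ⟨⟨0, 1, 0, 0⟩, 0⟩

@[simp] theorem imUnit_fst_re : imUnit.fst.re = 0 := rfl
@[simp] theorem imUnit_fst_imI : imUnit.fst.imI = 1 := rfl
@[simp] theorem imUnit_fst_imJ : imUnit.fst.imJ = 0 := rfl
@[simp] theorem imUnit_fst_imK : imUnit.fst.imK = 0 := rfl
@[simp] theorem imUnit_snd : imUnit.snd = 0 := rfl

/-- The derivation `½ [Ã₃¹(1), Ã₃¹(e)]`; see `rot_apply`. -/
def rot : Module.End ℝ J1 := (2⁻¹ : ℝ) • ⁅A3 1, A3 imUnit⁆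

/-- The diagonal is killed and no two octonion coordinates are mixed, so `rot` commutes with `σ`.
Left multiplication by `e`, right multiplication by `e` and minus their sum form an infinitesimal
triality triple. -/
theorem rot_apply (X : J1) : rot X =
    ⟨0, 0, 0, imUnit * X.x₁, X.x₂ * imUnit, -(imUnit * X.x₃ + X.x₃ * imUnit)⟩ := by
  ext1
  · simp [rot, Ring.lie_def, A3, Oct.inner]
  · simp [rot, Ring.lie_def, A3, Oct.inner]
  · simp [rot, Ring.lie_def, A3, Oct.inner]
  · ext <;> simp [rot, Ring.lie_def, A3] <;> ring
  · ext <;> simp [rot, Ring.lie_def, A3] <;> ring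
  · ext <;> simp [rot, Ring.lie_def, A3, Oct.inner] <;> ring

theorem rot_mem_f4 : rot ∈ f4 := f4.smul_mem _ (lie_mem_f4 (A3_mem_f4 _) (A3_mem_f4 _))

/-- With `lie_rot_A3_imUnit`, this says that `ad rot` is an infinitesimal rotation of speed `2` in
the plane of `A3 1` and `A3 imUnit`. -/
theorem lie_rot_A3_one : ⁅rot, A3 1⁆ = -(2 : ℝ) • A3 imUnit := by
  ext1 X
  rw [Ring.lie_def, LinearMap.sub_apply, Module.End.mul_apply, Module.End.mul_apply, rot_apply,
    rot_apply]
  ext1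
  · simp [A3, Oct.inner]; ring
  · simp [A3, Oct.inner]; ring
  · simp [A3]
  · ext <;> simp [A3] <;> ring
  · ext <;> simp [A3] <;> ring
  · ext <;> simp [A3] <;> ring

theorem lie_rot_A3_imUnit : ⁅rot, A3 imUnit⁆ = (2 : ℝ) • A3 1 := by
  ext1 X
  rw [Ring.lie_def, LinearMap.sub_apply, Module.End.mul_apply, Module.End.mul_apply, rot_apply,
    rot_apply]
  ext1
  · simp [A3, Oct.inner]; ring
  · simp [A3, Oct.inner]; ring
  · simp [A3]
  · ext <;> simp [A3] <;> ring
  · ext <;> simp [A3] <;> ring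
  · ext <;> simp [A3] <;> ring

theorem Ad_sigma_apply (φ : Module.End ℝ J1) (X : J1) :
    Ad sigma φ X = sigmaLin (φ (sigmaLin X)) := rfl

theorem theta_A3 (a : Oct ℝ) : theta (A3 a) = -A3 a := by
  ext1 X
  have h : Oct.inner a (-X.x₃) = -Oct.inner a X.x₃ := by
    simpa using Oct.inner_smul_right (-1) a X.x₃
  rw [theta, Ad_sigma_apply, LinearMap.neg_apply]
  ext1 <;> simp [sigmaLin, A3, h]

theorem theta_rot : theta rot = rot := by
  ext1 X
  rw [theta, Ad_sigma_apply, rot_apply, rot_apply]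
  ext1 <;> simp [sigmaLin, add_comm]

/-! ### Real eigenvalues of `Ã₃¹(1)` and the scalars by which `M^*` acts on `𝔞` -/

theorem eigenvalue_A3_one {c : ℝ} (hc : c ≠ 0) {v : J1} (hv : v ≠ 0) (h : A3 1 v = c • v) :
    c ^ 2 = 1 ∨ c ^ 2 = 4 := by
  obtain ⟨ξ₁, ξ₂, ξ₃, x₁, x₂, x₃⟩ := v
  simp only [A3, LinearMap.coe_mk, AddHom.coe_mk, J1.ext_iff, J1.ξ₁_smul, J1.ξ₂_smul, J1.ξ₃_smul,
    J1.x₁_smul, J1.x₂_smul, J1.x₃_smul, mul_one, one_mul] at h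
  obtain ⟨h1, h2, h3, h4, h5, h6⟩ := h
  by_contra! hcon
  obtain ⟨hc1, hc4⟩ := hcon
  -- The map swaps `x₁` and `x₂` up to conjugation, so its square is the identity on this pair and
  -- `c² ≠ 1` kills both.
  have hsq : ∀ x y : Oct ℝ, star y = c • x → star x = c • y → x = 0 := by
    intro x y e1 e2
    have e3 : x = c ^ 2 • x := by
      calc x = star (star x) := (star_star x).symm
        _ = c ^ 2 • x := by rw [e2, Oct.star_smul', e1, smul_smul, sq]
    have e4 : (c ^ 2 - 1) • x = 0 := by rw [sub_smul, ← e3, one_smul, sub_self]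
    exact (smul_eq_zero.1 e4).resolve_left (sub_ne_zero.2 hc1)
  have hr : Oct.inner 1 x₃ = x₃.fst.re := by simp [Oct.inner]
  have hre := congrArg (fun x : Oct ℝ => x.fst.re) h6
  simp only [Oct.fst_smul, Quaternion.re_smul, Oct.fst_one, Quaternion.re_one, smul_eq_mul,
    mul_one] at hre
  -- What remains couples `ξ₂ - ξ₁` with `Re x₃`; there the square of the map is `4`.
  rw [hr] at h1 h2
  have hr0 : x₃.fst.re = 0 := by
    have : (c ^ 2 - 4) * x₃.fst.re = 0 := by linear_combination -c * hre + h1 - h2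
    exact (mul_eq_zero.1 this).resolve_left (sub_ne_zero.2 hc4)
  rw [hr0, mul_zero] at h1 h2
  have e1 : ξ₁ = 0 := (mul_eq_zero.1 h1.symm).resolve_left hc
  have e2 : ξ₂ = 0 := (mul_eq_zero.1 h2.symm).resolve_left hc
  have e3 : ξ₃ = 0 := (mul_eq_zero.1 h3.symm).resolve_left hc
  have e6 : x₃ = 0 := by
    rw [e1, e2, sub_self, zero_smul] at h6
    exact (smul_eq_zero.1 h6.symm).resolve_left hc
  exact hv (by ext1 <;> simp only [e1, e2, e3, e6, hsq x₁ x₂ h4 h5, hsq x₂ x₁ h5 h4] <;> rfl)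

/-- If `v` is an eigenvector of `A3 1` for `2`, then `k v` is one of `t • A3 1` for `2`, hence one
of `A3 1` for `2 / t`. -/
theorem sq_of_Ad_A3_one {k : F4} {t : ℝ} (h : Ad k (A3 1) = t • A3 1) :
    t ≠ 0 ∧ ((2 / t) ^ 2 = 1 ∨ (2 / t) ^ 2 = 4) := by
  have ht : t ≠ 0 := by
    rintro rfl
    rw [zero_smul] at h
    exact A3_one_ne_zero ((Ad k).map_eq_zero_iff.1 h)
  refine ⟨ht, ?_⟩
  let v : J1 := ⟨-1, 1, 0, 0, 0, 1⟩
  have hv : v ≠ 0 := fun h => by simpa [v] using congrArg J1.ξ₂ h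
  have hAv : A3 1 v = (2 : ℝ) • v := by
    ext1 <;> simp [v, A3, Oct.inner]
    norm_num
  refine eigenvalue_A3_one (div_ne_zero two_ne_zero ht) (v := (k : J1 ≃ₗ[ℝ] J1) v) ?_ ?_
  · exact fun h => hv ((k : J1 ≃ₗ[ℝ] J1).map_eq_zero_iff.1 h)
  · have h1 := Ad_apply_apply k (A3 1) ((k : J1 ≃ₗ[ℝ] J1) v)
    rw [LinearEquiv.symm_apply_apply, hAv, h, LinearMap.smul_apply, map_smul] at h1
    rw [div_eq_inv_mul, mul_smul, ← h1, smul_smul, inv_mul_cancel₀ ht, one_smul]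

/-- The eigenvalue argument for `k` allows `t² ∈ {1, 4}`, and for `k⁻¹` it allows `t² ∈ {1, 1/4}`;
only `1` is common. -/
theorem eq_one_or_neg_one_of_Ad_A3_one {k : F4} {t : ℝ} (h : Ad k (A3 1) = t • A3 1) :
    t = 1 ∨ t = -1 := by
  obtain ⟨ht, h1⟩ := sq_of_Ad_A3_one h
  have h' : Ad k⁻¹ (A3 1) = t⁻¹ • A3 1 := by
    have := congrArg (Ad k⁻¹) h
    rw [Ad_inv_Ad, map_smul] at this
    nth_rewrite 2 [this]
    rw [smul_smul, inv_mul_cancel₀ ht, one_smul]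
  obtain ⟨-, h2⟩ := sq_of_Ad_A3_one h'
  rw [div_pow, div_eq_iff (pow_ne_zero 2 ht), div_eq_iff (pow_ne_zero 2 ht)] at h1
  rw [div_inv_eq_mul, mul_pow] at h2
  have h3 : (t - 1) * (t + 1) = 0 := by
    rcases h1 with h1 | h1 <;> rcases h2 with h2 | h2 <;> linarith
  exact (mul_eq_zero.1 h3).imp sub_eq_zero.1 eq_neg_of_add_eq_zero_left

/-! ### The element `σ` and the two cosets of `M` in `M^*` -/

theorem sigma_mul_sigma : sigma * sigma = 1 :=
  Subtype.ext (LinearEquiv.ext sigmaLin_sigmaLin)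

theorem sigma_inv : sigma⁻¹ = sigma := inv_eq_of_mul_eq_one_left sigma_mul_sigma

theorem sigma_mem_K : sigma ∈ K := mul_inv_cancel_right sigma sigma

theorem Ad_sigma_A3 (a : Oct ℝ) : Ad sigma (A3 a) = -A3 a := theta_A3 a

theorem A3_one_mem_aAlg : A3 1 ∈ aAlg := Submodule.mem_span_singleton_self _

theorem mem_Mstar_of_Ad_neg {k : F4} (hk : k ∈ K) (h : Ad k (A3 1) = -A3 1) : k ∈ Mstar := by
  refine ⟨hk, ?_⟩
  have h' : aAlg.map (Ad k : Module.End ℝ J1 →ₗ[ℝ] Module.End ℝ J1) = aAlg := by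
    rw [Submodule.map_span, Set.image_singleton]
    change Submodule.span ℝ {Ad k (A3 1)} = _
    rw [h, ← Set.neg_singleton, Submodule.span_neg]
  exact congrArg (fun S : Submodule ℝ (Module.End ℝ J1) => (S : Set (Module.End ℝ J1))) h'

theorem sigma_mem_Mstar : sigma ∈ Mstar := mem_Mstar_of_Ad_neg sigma_mem_K (Ad_sigma_A3 1)

theorem sigma_mul_mem_M_of_Ad_neg {k : F4} (hk : k ∈ K) (h : Ad k (A3 1) = -A3 1) :
    sigma * k ∈ M :=
  ⟨mul_mem sigma_mem_K hk, by rw [Ad_mul, h, map_neg, Ad_sigma_A3, neg_neg]⟩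

theorem sigma_notMem_M : sigma ∉ M := fun h => by
  have h1 := h.2
  rw [Ad_sigma_A3] at h1
  have h2 : (2 : ℝ) • A3 1 = 0 := by
    nth_rewrite 1 [two_smul, ← h1]
    exact neg_add_cancel _
  exact A3_one_ne_zero ((smul_eq_zero.1 h2).resolve_left two_ne_zero)

theorem mem_M_or_sigma_mul_mem_M {k : F4} (hk : k ∈ Mstar) : k ∈ M ∨ sigma * k ∈ M := by
  have h : Ad k (A3 1) ∈ (aAlg : Set (Module.End ℝ J1)) := by
    rw [← hk.2]
    exact ⟨_, A3_one_mem_aAlg, rfl⟩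
  obtain ⟨t, ht⟩ := Submodule.mem_span_singleton.1 h
  rcases eq_one_or_neg_one_of_Ad_A3_one ht.symm with rfl | rfl
  · exact Or.inl ⟨hk.1, by rw [← ht, one_smul]⟩
  · exact Or.inr (sigma_mul_mem_M_of_Ad_neg hk.1 (by rw [← ht, neg_one_smul]))

/-! ### Root vectors for `±2α` and an element of `𝔨_ε` -/

theorem mem_rootSpace_of_lie {φ : Module.End ℝ J1} (hφ : φ ∈ f4) {c : ℝ}
    (h : ⁅A3 1, φ⁆ = c • φ) : φ ∈ rootSpace (c • alpha) := by
  refine ⟨hφ, fun ⟨H, hH⟩ => ?_⟩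
  obtain ⟨t, rfl⟩ := Submodule.mem_span_singleton.1 hH
  have e : (⟨t • A3 1, hH⟩ : aAlg) = t • ⟨A3 1, A3_one_mem_aAlg⟩ := rfl
  rw [e, map_smul, LinearMap.smul_apply, alpha_A3_one, smul_eq_mul, smul_eq_mul, mul_one, mul_smul,
    ← h]
  simp only [Submodule.coe_smul, Ring.lie_def, smul_sub, smul_mul_assoc, mul_smul_comm]

theorem smul_alpha_eq_iff {c d : ℝ} : c • alpha = d • alpha ↔ c = d := by
  refine ⟨fun h => ?_, fun h => by rw [h]⟩
  have := congrArg (fun l : Module.Dual ℝ aAlg => l ⟨A3 1, A3_one_mem_aAlg⟩) h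
  simpa [alpha_A3_one] using this

/-- Here `c = ±2`, so `φ` lies in the root space of `±2α`, where `ε = 1` and `θ_ε` agrees with `θ`.
-/
theorem mem_thetaEpsGraph_of_lie {φ : Module.End ℝ J1} (hφ : φ ∈ f4) {c : ℝ} (hc : c ^ 2 = 4)
    (h : ⁅A3 1, φ⁆ = c • φ) : (φ, theta φ) ∈ thetaEpsGraph := by
  -- The functional `c • alpha` counts as a root only if its root space is nonzero, which a nonzero
  -- `φ` witnesses.
  by_cases h0 : φ = 0
  · rw [h0, map_zero]
    exact zero_mem _
  have h1 := mem_rootSpace_of_lie hφ h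
  refine Submodule.subset_span (Or.inl ⟨c • alpha, ⟨?_, ?_⟩, h1, ?_⟩)
  · rw [← zero_smul ℝ alpha, Ne, smul_alpha_eq_iff]
    rintro rfl
    norm_num at hc
  · exact fun hbot => h0 ((Submodule.mem_bot ℝ).1 (hbot ▸ h1))
  · have : ¬(c • alpha = alpha ∨ c • alpha = -alpha) := by
      rintro (e | e)
      · rw [← one_smul ℝ alpha, smul_smul, mul_one, smul_alpha_eq_iff] at e
        rw [e] at hc; norm_num at hc
      · rw [← neg_one_smul ℝ alpha, smul_alpha_eq_iff] at e
        rw [e] at hc; norm_num at hc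
    rw [eps, if_neg this, one_smul]

theorem rot_mem_kEps : rot ∈ kEps := by
  refine ⟨rot_mem_f4, ?_⟩
  have e1 : ⁅A3 1, rot⁆ = (2 : ℝ) • A3 imUnit := by
    rw [Ring.lie_def, ← neg_sub, ← Ring.lie_def, lie_rot_A3_one, neg_smul, neg_neg]
  have e2 : ⁅A3 1, A3 imUnit⁆ = (2 : ℝ) • rot := by
    rw [rot, smul_smul, mul_inv_cancel₀ two_ne_zero, one_smul]
  have p := (mem_thetaEpsGraph_of_lie (φ := rot + A3 imUnit) (add_mem rot_mem_f4 (A3_mem_f4 _))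
    (c := 2) (by norm_num) (by
      rw [Ring.lie_def] at e1 e2 ⊢
      rw [mul_add, add_mul]
      linear_combination (norm := module) e1 + e2))
  have q := (mem_thetaEpsGraph_of_lie (φ := rot - A3 imUnit) (sub_mem rot_mem_f4 (A3_mem_f4 _))
    (c := -2) (by norm_num) (by
      rw [Ring.lie_def] at e1 e2 ⊢
      rw [mul_sub, sub_mul]
      linear_combination (norm := module) e1 - e2))
  rw [map_add, theta_rot, theta_A3] at p
  rw [map_sub, theta_rot, theta_A3] at q
  -- With `E = A3 imUnit`, the graph contains `(rot + E, rot - E)` and `(rot - E, rot + E)`; half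
  -- their sum is `(rot, rot)`.
  convert thetaEpsGraph.smul_mem (2⁻¹ : ℝ) (add_mem p q) using 1
  ext1 <;> simp only [Prod.smul_fst, Prod.smul_snd, Prod.fst_add, Prod.snd_add] <;> module

/-! ### Exponentiating `rot`: an element of `(K_ε)⁰` acting by `-1` on `𝔞` -/

/-- In a Banach algebra, `exp (t p) a = (cos 2t • a - sin 2t • b) exp (t p)` whenever
`[p, a] = -2 b` and `[p, b] = 2 a`. -/
theorem exp_smul_mul_of_lie {L : Type*} [NormedRing L] [NormedAlgebra ℝ L] [CompleteSpace L]
    {p a b : L} (ha : p * a - a * p = -(2 : ℝ) • b) (hb : p * b - b * p = (2 : ℝ) • a) (t : ℝ) :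
    NormedSpace.exp (t • p) * a =
      (Real.cos (2 * t) • a - Real.sin (2 * t) • b) * NormedSpace.exp (t • p) := by
  let _ : NormedAlgebra ℚ L := NormedAlgebra.restrictScalars ℚ ℝ L
  let F : ℝ → L := fun s => Real.cos (2 * s) • a - Real.sin (2 * s) • b
  let f : ℝ → L := fun s => NormedSpace.exp (-s • p) * F s * NormedSpace.exp (s • p)
  -- `F` solves the equation `F' = [p, F]` with `F 0 = a`, so its conjugate `f` by `exp(-s p)` has
  -- zero derivative and stays equal to `a`.
  have hF : ∀ s, HasDerivAt F (p * F s - F s * p) s := fun s => by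
    have h2 : HasDerivAt (fun s : ℝ => 2 * s) 2 s := by simpa using (hasDerivAt_id s).const_mul 2
    refine ((h2.cos.smul_const a).sub (h2.sin.smul_const b)).congr_deriv ?_
    have : p * F s - F s * p = Real.cos (2 * s) • (p * a - a * p) -
        Real.sin (2 * s) • (p * b - b * p) := by
      simp only [F, mul_sub, sub_mul, mul_smul_comm, smul_mul_assoc, smul_sub]
      abel
    rw [this, ha, hb]
    module
  have hf : ∀ s, HasDerivAt f 0 s := fun s => by
    have e1 : HasDerivAt (fun s : ℝ => NormedSpace.exp (-s • p))
        (-(NormedSpace.exp (-s • p) * p)) s := by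
      have := (hasDerivAt_exp_smul_const (𝕂 := ℝ) p (-s)).scomp s (hasDerivAt_neg s)
      simpa [Function.comp_def] using this
    refine ((e1.mul (hF s)).mul (hasDerivAt_exp_smul_const' (𝕂 := ℝ) p s)).congr_deriv ?_
    rw [Pi.mul_apply]
    noncomm_ring
  have hconst : f t = f 0 := is_const_of_deriv_eq_zero (fun s => (hf s).differentiableAt)
    (fun s => (hf s).deriv) t 0
  have hinv : NormedSpace.exp (t • p) * NormedSpace.exp (-t • p) = 1 := by
    rw [← NormedSpace.exp_add_of_commute (((Commute.refl p).smul_left t).smul_right (-t))]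
    simp
  have h0 : f 0 = a := by simp [f, F]
  calc NormedSpace.exp (t • p) * a = NormedSpace.exp (t • p) * f t := by rw [hconst, h0]
    _ = F t * NormedSpace.exp (t • p) := by simp only [f, ← mul_assoc, hinv, one_mul]

/-- At time `π/2` a rotation of speed `2` has turned by `π`, so the sine term vanishes and the
cosine is `-1`. -/
theorem expEnd_rot_mul_A3_one :
    expEnd ((Real.pi / 2) • rot) * A3 1 = -A3 1 * expEnd ((Real.pi / 2) • rot) := by
  let c : Module.End ℝ J1 ≃ₐ[ℝ] (J1 →L[ℝ] J1) := Module.End.toContinuousLinearMap J1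
  have ha : c rot * c (A3 1) - c (A3 1) * c rot = -(2 : ℝ) • c (A3 imUnit) := by
    rw [← map_mul, ← map_mul, ← map_sub, ← map_smul]
    exact congrArg c lie_rot_A3_one
  have hb : c rot * c (A3 imUnit) - c (A3 imUnit) * c rot = (2 : ℝ) • c (A3 1) := by
    rw [← map_mul, ← map_mul, ← map_sub, ← map_smul]
    exact congrArg c lie_rot_A3_imUnit
  have h := exp_smul_mul_of_lie ha hb (Real.pi / 2)
  rw [mul_div_cancel₀ Real.pi two_ne_zero, Real.cos_pi, Real.sin_pi, zero_smul, sub_zero,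
    neg_one_smul] at h
  apply c.injective
  rw [map_mul, map_mul, map_neg, expEnd, map_smul]
  exact h

theorem F4.toEnd_injective : Function.Injective F4.toEnd := fun _ _ h =>
  Subtype.ext (LinearEquiv.toLinearMap_injective h)

theorem Ad_of_mul_eq {g : F4} {φ ψ : Module.End ℝ J1} (h : F4.toEnd g * φ = ψ * F4.toEnd g) :
    Ad g φ = ψ := by
  ext1 X
  have := LinearMap.congr_fun h ((g : J1 ≃ₗ[ℝ] J1).symm X)
  refine this.trans (congrArg ψ ?_)
  exact (g : J1 ≃ₗ[ℝ] J1).apply_symm_apply X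

theorem exists_mem_KEps0_Ad_neg : ∃ g ∈ KEps0, g ∈ K ∧ Ad g (A3 1) = -A3 1 := by
  obtain ⟨g, hg⟩ := rot_mem_f4 (Real.pi / 2)
  refine ⟨g, Subgroup.subset_closure ⟨_, kEps.smul_mem _ rot_mem_kEps, hg⟩, ?_, ?_⟩
  · refine F4.toEnd_injective ?_
    change Ad sigma (F4.toEnd g) = F4.toEnd g
    rw [hg, ← expEnd_Ad, map_smul]
    exact congrArg (fun φ => expEnd ((Real.pi / 2) • φ)) theta_rot
  · exact Ad_of_mul_eq (hg ▸ expEnd_rot_mul_A3_one)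

theorem sigma_mem_KEps : sigma ∈ KEps := by
  obtain ⟨g, hg, hK, hA⟩ := exists_mem_KEps0_Ad_neg
  have h := inv_mem (sigma_mul_mem_M_of_Ad_neg hK hA)
  -- The factorization is `σ = g (σg)⁻¹`, with `g ∈ (K_ε)⁰` and `(σg)⁻¹ ∈ M`.
  exact ⟨g, hg, _, h, by rw [mul_inv_rev, mul_inv_cancel_left, sigma_inv]⟩

/-! ### The coset decomposition and the groups of order two -/

theorem MstarEps_eq_Mstar : MstarEps = Mstar := by
  refine le_antisymm inf_le_right (le_inf (fun k hk => ?_) le_rfl)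
  rcases mem_M_or_sigma_mul_mem_M hk with h | h
  · exact (M_le_MstarEps h).1
  · have := mul_mem sigma_mem_KEps (M_le_MstarEps h).1
    rwa [← mul_assoc, sigma_mul_sigma, one_mul] at this

theorem coe_Mstar : (Mstar : Set F4) = (M : Set F4) ∪ (fun m => sigma * m) '' (M : Set F4) := by
  ext k
  refine ⟨fun hk => ?_, ?_⟩
  · refine (mem_M_or_sigma_mul_mem_M hk).imp id fun h => ⟨_, h, ?_⟩
    change sigma * (sigma * k) = k
    rw [← mul_assoc, sigma_mul_sigma, one_mul]
  · rintro (h | ⟨m, hm, rfl⟩)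
    · exact M_le_Mstar h
    · exact mul_mem sigma_mem_Mstar (M_le_Mstar hm)

theorem disjoint_M_sigma_mul_M :
    Disjoint (M : Set F4) ((fun m => sigma * m) '' (M : Set F4)) := by
  rw [Set.disjoint_left]
  rintro _ h ⟨m, hm, rfl⟩
  exact sigma_notMem_M ((mul_mem_cancel_right hm).1 h)

theorem one_ne_mk_sigma : (1 : W) ≠ ((⟨sigma, sigma_mem_Mstar⟩ : Mstar) : W) := fun h =>
  sigma_notMem_M ((QuotientGroup.eq_one_iff (N := M.subgroupOf Mstar) _).1 h.symm)

theorem univ_W : (Set.univ : Set W) = {(1 : W), ((⟨sigma, sigma_mem_Mstar⟩ : Mstar) : W)} := by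
  refine (Set.eq_univ_of_forall fun w => ?_).symm
  obtain ⟨k, rfl⟩ := QuotientGroup.mk_surjective w
  rcases mem_M_or_sigma_mul_mem_M k.2 with h | h
  · exact Or.inl ((QuotientGroup.eq_one_iff _).2 h)
  · refine Or.inr (QuotientGroup.eq.2 ?_).symm
    change sigma⁻¹ * (k : F4) ∈ M
    rwa [sigma_inv]

theorem WEps_eq_top : WEps = ⊤ := by
  rw [WEps, MstarEps_eq_Mstar, Subgroup.subgroupOf_self, ← MonoidHom.range_eq_map]
  exact QuotientGroup.range_mk' _

theorem one_ne_sigma : (1 : F4) ≠ sigma := fun h => sigma_notMem_M (h ▸ one_mem M)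

theorem coe_zpowers_sigma : (Subgroup.zpowers sigma : Set F4) = {1, sigma} := by
  ext g
  refine ⟨?_, ?_⟩
  · rintro ⟨n, rfl⟩
    rcases Int.even_or_odd' n with ⟨m, rfl | rfl⟩
    · left
      simp [zpow_mul, zpow_ofNat, sq, sigma_mul_sigma]
    · right
      simp [zpow_add, zpow_mul, zpow_ofNat, sq, sigma_mul_sigma]
  · rintro (rfl | rfl)
    · exact one_mem _
    · exact Subgroup.mem_zpowers _

theorem natCard_eq_two_of_univ_eq {G : Type*} [Group G] {g : G} (hg : 1 ≠ g)
    (hG : (Set.univ : Set G) = {1, g}) : Nat.card G = 2 := by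
  rw [← Set.ncard_univ, hG, Set.ncard_pair hg]

/-- Any isomorphism between groups of order two matches the nontrivial elements. The isomorphism
obtained from cardinalities alone is therefore automatically the coset map `g ↦ gM` when applied to
`{1, σ}`. -/
theorem exists_mulEquiv_of_univ_eq {G H : Type*} [Group G] [Group H] {g : G} {h : H}
    (hg : 1 ≠ g) (hG : (Set.univ : Set G) = {1, g}) (hh : 1 ≠ h)
    (hH : (Set.univ : Set H) = {1, h}) : ∃ e : G ≃* H, e g = h := by
  let e : G ≃* H := mulEquivOfPrimeCardEq (natCard_eq_two_of_univ_eq hg hG)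
    (natCard_eq_two_of_univ_eq hh hH)
  refine ⟨e, ?_⟩
  have h1 : e g ∈ ({1, h} : Set H) := hH ▸ Set.mem_univ _
  exact h1.resolve_left fun h2 => hg (e.map_eq_one_iff.1 h2).symm

theorem nonempty_mulEquiv_zmod_two {G : Type*} [Group G] {g : G} (hg : 1 ≠ g)
    (hG : (Set.univ : Set G) = {1, g}) : Nonempty (G ≃* Multiplicative (ZMod 2)) :=
  ⟨mulEquivOfPrimeCardEq (natCard_eq_two_of_univ_eq hg hG) (by simp)⟩

end ExcF4
end

/-- Part (1): `M^*` is the disjoint union of `M` and `σM`, the Weyl group `W = M^*/M` consists of the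
cosets `M` and `σM`, and `{1, σ} ≅ W` by `g ↦ gM`; both groups are cyclic of order two.
Part (2): the same for `M_ε^*` and `W_ε`; moreover `M_ε^* = M^*` and `[W : W_ε] = 1`. -/
theorem proposition9p3 :
    -- Part (1)
    ((Mstar : Set F4) = (M : Set F4) ∪ (fun m => sigma * m) '' (M : Set F4) ∧
      Disjoint (M : Set F4) ((fun m => sigma * m) '' (M : Set F4))) ∧
    (Subgroup.zpowers sigma : Set F4) = {1, sigma} ∧
    Nonempty (Subgroup.zpowers sigma ≃* Multiplicative (ZMod 2)) ∧
    ∃ hσ : sigma ∈ Mstar,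
      ((1 : W) ≠ ((⟨sigma, hσ⟩ : Mstar) : W) ∧
        (Set.univ : Set W) = {(1 : W), ((⟨sigma, hσ⟩ : Mstar) : W)} ∧
        (∃ e : Subgroup.zpowers sigma ≃* W,
          e ⟨sigma, Subgroup.mem_zpowers sigma⟩ = ((⟨sigma, hσ⟩ : Mstar) : W)) ∧
        Nonempty (W ≃* Multiplicative (ZMod 2))) ∧
    -- Part (2)
      (MstarEps = Mstar ∧
        (MstarEps : Set F4) = (M : Set F4) ∪ (fun m => sigma * m) '' (M : Set F4) ∧
        (WEps : Set W) = {(1 : W), ((⟨sigma, hσ⟩ : Mstar) : W)} ∧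
        (∃ e : Subgroup.zpowers sigma ≃* WEps,
          (e ⟨sigma, Subgroup.mem_zpowers sigma⟩ : W) = ((⟨sigma, hσ⟩ : Mstar) : W)) ∧
        Nonempty (WEps ≃* Multiplicative (ZMod 2)) ∧
        WEps = ⊤ ∧
        WEps.index = 1) := by
  have hz1 : (1 : Subgroup.zpowers sigma) ≠ ⟨sigma, Subgroup.mem_zpowers sigma⟩ := fun h =>
    one_ne_sigma (congrArg Subtype.val h)
  have hz : (Set.univ : Set (Subgroup.zpowers sigma)) =
      {1, ⟨sigma, Subgroup.mem_zpowers sigma⟩} := by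
    refine (Set.eq_univ_of_forall fun g => ?_).symm
    have hg : (g : F4) ∈ ({1, sigma} : Set F4) := coe_zpowers_sigma ▸ g.2
    exact hg.imp (fun h => Subtype.ext h) fun h => Subtype.ext h
  have hs : ((⟨sigma, sigma_mem_Mstar⟩ : Mstar) : W) ∈ WEps := WEps_eq_top ▸ Subgroup.mem_top _
  have hw1 : (1 : WEps) ≠ ⟨_, hs⟩ := fun h => one_ne_mk_sigma (congrArg Subtype.val h)
  have hw : (Set.univ : Set WEps) = {1, ⟨_, hs⟩} := by
    refine (Set.eq_univ_of_forall fun g => ?_).symm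
    have hg : (g : W) ∈ ({1, ((⟨sigma, sigma_mem_Mstar⟩ : Mstar) : W)} : Set W) :=
      univ_W ▸ Set.mem_univ _
    exact hg.imp (fun h => Subtype.ext h) fun h => Subtype.ext h
  refine ⟨⟨coe_Mstar, disjoint_M_sigma_mul_M⟩, coe_zpowers_sigma,
    nonempty_mulEquiv_zmod_two hz1 hz, sigma_mem_Mstar,
    ⟨one_ne_mk_sigma, univ_W, exists_mulEquiv_of_univ_eq hz1 hz one_ne_mk_sigma univ_W,
      nonempty_mulEquiv_zmod_two one_ne_mk_sigma univ_W⟩,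
    MstarEps_eq_Mstar, MstarEps_eq_Mstar ▸ coe_Mstar, ?_, ?_,
    nonempty_mulEquiv_zmod_two hw1 hw, WEps_eq_top, ?_⟩
  · rw [WEps_eq_top, Subgroup.coe_top, univ_W]
  · obtain ⟨e, he⟩ := exists_mulEquiv_of_univ_eq hz1 hz hw1 hw
    exact ⟨e, congrArg Subtype.val he⟩
  · rw [WEps_eq_top, Subgroup.index_top]
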